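/- Let $\mathcal H$ be a separable real Hilbert space, $\mathcal Y$ a real Banach space, $\mathcal K\subset\mathcal Y$ a nonempty closed convex cone with positive polar cone $\mathcal K^+=\{v^*\in\mathcal Y^*:\langle v^*,y\rangle\ge 0\ \forall y\in\mathcal K\}$, and $\mathcal C\subset\mathcal Y^*$ a weak$^*$-compact convex set with $\operatorname{cl}^{w^*}\operatorname{cone}\mathcal C=\mathcal K^+$. Let $\Phi:\mathcal H\times\mathbb R^m\to\mathcal Y$ be continuous and such that $(x,z)\mapsto\langle v^*,\Phi(x,z)\rangle$ is convex for every $v^*\in\mathcal C$, and let $\xi$ be an $m$-dimensional random vector on a probability space $(\Omega,\mathcal F,\mathbb P)$. For $f:E\to\mathbb R\cup\{+\infty\}$ on a Hilbert space $E$ and $\lambda>0$ let $f_\lambda(x)=\inf_{z\in E}\big(f(z)+\tfrac1{2\lambda}\|x-z\|^2\big)$ be its Moreau envelope. Put $S_\Phi(x,z)=\sup_{v^*\in\mathcal C}\langle v^*,\Phi(x,z)\rangle$, let $\Phi_\lambda=(S_\Phi)_\lambda$ be its Moreau envelope on the Hilbert space $\mathcal H\times\mathbb R^m$ (norm $\sqrt{\|x\|^2+\|z\|^2}$),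 and define $$\varphi(x)=\mathbb P(\Phi(x,\xi)\in-\mathcal K),\quad \varphi_\lambda(x)=\mathbb P(\Phi_\lambda(x,\xi)\le 0),\quad M(p)=\{x:\varphi(x)\ge p\},\quad M_\lambda(p)=\{x:\varphi_\lambda(x)\ge p\}.$$ For $\alpha\in[-\infty,\infty]$, $a,b\ge 0$ and $t\in[0,1]$ let $m_\alpha(a,b,t)=0$ if $ab=0$; if $ab>0$, let $m_\alpha(a,b,t)$ be $a^tb^{1-t}$ for $\alpha=0$, $\max\{a,b\}$ for $\alpha=\infty$, $\min\{a,b\}$ for $\alpha=-\infty$, and $(ta^\alpha+(1-t)b^\alpha)^{1/\alpha}$ otherwise. A function $f\ge0$ is $\alpha$-concave on a convex set $D$ if $f(tx+(1-t)y)\ge m_\alpha(f(x),f(y),t)$ for all $x,y\in D$, $t\in[0,1]$. Suppose that the distribution $\mathbb P_\xi$ of $\xi$ is $\alpha$-concave for some $\alpha\in[-\infty,\infty]$, that is, $\mathbb P_\xi(tA+(1-t)B)\ge m_\alpha(\mathbb P_\xi(A),\mathbb P_\xi(B),t)$ for all Borel sets $A,B\subset\mathbb R^m$ and $t\in[0,1]$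 (the left-hand side being the outer measure if $tA+(1-t)B$ is not Borel). Then: 1. For every $\lambda>0$, the set $\{x:\exists z\in\mathbb R^m,\ \Phi_\lambda(x,z)\le0\}$ is convex and $\varphi_\lambda$ is $\alpha$-concave on it; the set $\{x:\exists z\in\mathbb R^m,\ \Phi(x,z)\in-\mathcal K\}$ is convex and $\varphi$ is $\alpha$-concave on it. 2. For every $p\in[0,1]$, the sets $M(p)$ and $M_\lambda(p)$, $\lambda>0$, are convex. 3. Let $p\in[0,1]$ and let $\psi:\mathcal H\to\mathbb R\cup\{+\infty\}$ be convex, lower semicontinuous and coercive (all sets $\{\psi\le a\}$, $a\in\mathbb R$, are bounded), with $M(p)\cap\operatorname{int}(\operatorname{dom}\psi)\neq\emptyset$, where $\operatorname{dom}\psi=\{\psi<+\infty\}$. Suppose that the conjugate $\psi^*(u)=\sup_y(\langle u,y\rangle-\psi(y))$ is Fréchet differentiable at every $u$ with $\partial\psi^*(u)\ne\emptyset$ (in particular finite near such $u$), where $\partial$ is the convex subdifferential. Then the problem $(P)$ of minimizing $\psi$ over $M(p)$ has exactly one solution $x_0$; for every $\lambda>0$ the problem $(P_\lambda)$ of minimizing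 $\psi_\lambda$ over $M_\lambda(p)$ has exactly one solution $x_\lambda$; and $x_\lambda\to x_0$ in norm as $\lambda\to0^+$. -/

import Mathlib

open MeasureTheory Filter Topology

noncomputable section

namespace ChanceConstrained

/-! ### Convex analysis for functions with values in `ℝ ∪ {+∞}` -/

/-- The Moreau envelope of `f` with parameter `l > 0`. -/
def moreauEnvelope {E : Type*} [NormedAddCommGroup E] (f : E → EReal) (l : ℝ) (x : E) : EReal :=
  ⨅ z : E, f z + ((1 / (2 * l) * ‖x - z‖ ^ 2 : ℝ) : EReal)

/-- The effective domain. -/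
def effDom {E : Type*} (f : E → EReal) : Set E := {x | f x < ⊤}

/-- Convexity of an extended-real-valued function: its epigraph is convex. -/
def ConvexFun {E : Type*} [AddCommGroup E] [Module ℝ E] (f : E → EReal) : Prop :=
  Convex ℝ {q : E × ℝ | f q.1 ≤ (q.2 : EReal)}

/-- Coercivity: all real sublevel sets are bounded. -/
def CoerciveFun {E : Type*} [NormedAddCommGroup E] (f : E → EReal) : Prop :=
  ∀ a : ℝ, Bornology.IsBounded {x | f x ≤ (a : EReal)}

/-- The Legendre-Fenchel conjugate. -/
def conjugate {E : Type*} [NormedAddCommGroup E] [InnerProductSpace ℝ E] (f : E → EReal) (z : E) :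
    EReal :=
  ⨆ y : E, ((inner ℝ z y : ℝ) : EReal) - f y

/-- The convex subdifferential; it is empty outside the effective domain. -/
def subdiff {E : Type*} [NormedAddCommGroup E] [InnerProductSpace ℝ E] (f : E → EReal) (x : E) :
    Set E :=
  {z | f x < ⊤ ∧ ∀ y, f x + ((inner ℝ z (y - x) : ℝ) : EReal) ≤ f y}

/-- Fréchet differentiability at `x` of an extended-real-valued function: it is finite near `x`,
and as a real-valued function near `x` it is Fréchet differentiable at `x`. -/
def FrechetDifferentiableAt {E : Type*} [NormedAddCommGroup E] [NormedSpace ℝ E]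
    (f : E → EReal) (x : E) : Prop :=
  (∀ᶠ y in 𝓝 x, f y ≠ ⊤ ∧ f y ≠ ⊥) ∧ DifferentiableAt ℝ (fun y => (f y).toReal) x

/-- `x` is an optimal solution of: minimize `f` subject to `x ∈ M`. -/
def IsOptimal {E : Type*} (f : E → EReal) (M : Set E) (x : E) : Prop :=
  x ∈ M ∧ ∀ y ∈ M, f x ≤ f y

/-! ### Generalized concavity -/

/-- The generalized mean of `a, b ≥ 0` of order `α ∈ [-∞, ∞]` with weights `t, 1 - t`,
set to zero if `a` or `b` vanishes. -/
def genMean (α : EReal) (a b t : ℝ) : ℝ :=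
  open Classical in
  if a * b = 0 then 0
  else if α = 0 then a ^ t * b ^ (1 - t)
  else if α = ⊤ then max a b
  else if α = ⊥ then min a b
  else (t * a ^ α.toReal + (1 - t) * b ^ α.toReal) ^ (1 / α.toReal)

/-- A nonnegative function `f` is `α`-concave on the convex set `D`. -/
def AlphaConcaveOn {E : Type*} [AddCommGroup E] [Module ℝ E] (α : EReal) (D : Set E) (f : E → ℝ) :
    Prop :=
  Convex ℝ D ∧ (∀ x ∈ D, 0 ≤ f x) ∧
    ∀ x ∈ D, ∀ y ∈ D, ∀ t ∈ Set.Icc (0 : ℝ) 1,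
      genMean α (f x) (f y) t ≤ f (t • x + (1 - t) • y)

/-- A measure is `α`-concave. The Minkowski combination of two Borel sets need not be Borel, and
its measure is the outer measure, which is its measure under the completion. -/
def AlphaConcaveMeasure {E : Type*} [AddCommGroup E] [Module ℝ E] [MeasurableSpace E]
    (α : EReal) (μ : Measure E) : Prop :=
  ∀ A B : Set E, MeasurableSet A → MeasurableSet B → ∀ t ∈ Set.Icc (0 : ℝ) 1,
    genMean α (μ.real A) (μ.real B) t ≤
      μ.real {w | ∃ a ∈ A, ∃ b ∈ B, w = t • a + (1 - t) • b}

/-! ### Conic probability functions and their inner Moreau regularization -/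

variable {H : Type*} [NormedAddCommGroup H] {Y : Type*} [NormedAddCommGroup Y] [NormedSpace ℝ Y]
  {m : ℕ} {Ω : Type*} [MeasurableSpace Ω]

/-- The weak-star compact convex set `C` generates the positive polar cone of `K`: the weak-star
closure of the cone generated by `C` is the set of functionals that are nonnegative on `K`. -/
def GeneratesPolar (C : Set (WeakDual ℝ Y)) (K : ConvexCone ℝ Y) : Prop :=
  IsCompact C ∧ Convex ℝ C ∧
    closure {w : WeakDual ℝ Y | ∃ t : ℝ, 0 ≤ t ∧ ∃ v ∈ C, w = t • v} =
      {w : WeakDual ℝ Y | ∀ y ∈ K, 0 ≤ w y}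

/-- The supremum of the scalarizations of `Φ` over `C`, on the Hilbert product `H × ℝ^m`. -/
def supFun (C : Set (WeakDual ℝ Y)) (Φ : H → EuclideanSpace ℝ (Fin m) → Y)
    (w : WithLp 2 (H × EuclideanSpace ℝ (Fin m))) : EReal :=
  ⨆ v ∈ C, ((v (Φ w.fst w.snd) : ℝ) : EReal)

/-- The Moreau envelope, jointly in `(x, z)`, of the supremum function. -/
def regFun (C : Set (WeakDual ℝ Y)) (Φ : H → EuclideanSpace ℝ (Fin m) → Y) (l : ℝ)
    (x : H) (z : EuclideanSpace ℝ (Fin m)) : EReal :=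
  moreauEnvelope (supFun C Φ) l (WithLp.toLp 2 (x, z))

/-- The probability function `φ(x) = ℙ(Φ(x, ξ) ∈ -K)`. -/
def probFun (P : Measure Ω) (ξ : Ω → EuclideanSpace ℝ (Fin m)) (K : ConvexCone ℝ Y)
    (Φ : H → EuclideanSpace ℝ (Fin m) → Y) (x : H) : ℝ :=
  P.real {ω | -Φ x (ξ ω) ∈ K}

/-- The inner regularization `φ_l(x) = ℙ(Φ_l(x, ξ) ≤ 0)`. -/
def regProbFun (P : Measure Ω) (ξ : Ω → EuclideanSpace ℝ (Fin m)) (C : Set (WeakDual ℝ Y))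
    (Φ : H → EuclideanSpace ℝ (Fin m) → Y) (l : ℝ) (x : H) : ℝ :=
  P.real {ω | regFun C Φ l x (ξ ω) ≤ 0}

/-- The feasible set `M(p)`. -/
def feasible (P : Measure Ω) (ξ : Ω → EuclideanSpace ℝ (Fin m)) (K : ConvexCone ℝ Y)
    (Φ : H → EuclideanSpace ℝ (Fin m) → Y) (p : ℝ) : Set H :=
  {x | p ≤ probFun P ξ K Φ x}

/-- The regularized feasible set `M_l(p)`. -/
def regFeasible (P : Measure Ω) (ξ : Ω → EuclideanSpace ℝ (Fin m)) (C : Set (WeakDual ℝ Y))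
    (Φ : H → EuclideanSpace ℝ (Fin m) → Y) (l p : ℝ) : Set H :=
  {x | p ≤ regProbFun P ξ C Φ l x}

end ChanceConstrained

end

/-! By the bipolar theorem, `-Φ x z ∈ K` means `supFun C Φ ≤ 0` at `(x, z)`. Hence the original and
the regularized probability functions all have one form: the probability that `(x, ξ)` lies in a
closed convex set `F`. The Minkowski combination of two sections of `F` lies in the section over the
combined point, so `α`-concavity passes from the law of `ξ` to these functions. Every mean `genMean
α` of positive numbers is at least their minimum, so superlevel sets are convex; they are closed by
a reverse Fatou argument.

For the optimization part, differentiability of the conjugate at a subgradient `u` of `ψ` at `x₀`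
makes `x₀` the strong minimizer of `ψ - ⟨u, ·⟩` (`exists_pos_forall_norm_sub_le`). Combined with the
first-order condition `IsOptimal.exists_subgradient`, this gives uniqueness for `(P)`. For `(P_λ)`
it is applied at the proximal points, since a subgradient of the envelope is a subgradient of `ψ`
there.

For convergence, the sets `M_λ(p)` decrease to `M(p)` as `λ` decreases to zero, which forces the
lower limit of `⟨u, x_λ - x₀⟩` to be nonnegative. The proximal points of `x_λ` then nearly minimize
the tilted function, and strong minimality gives norm convergence. Weak compactness enters only
through nested bounded closed convex sets (`exists_mem_forall_of_antitone`). -/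

namespace ChanceConstrained

/-! ### Minimizers, subgradients and strong minimality in Hilbert space -/

section Hilbert

variable {E : Type*} [NormedAddCommGroup E] [InnerProductSpace ℝ E]

/-- A decreasing sequence of nonempty bounded closed convex sets in a Hilbert space has a common
point: the points of minimal norm form a Cauchy sequence. -/
theorem exists_mem_forall_of_antitone [CompleteSpace E] (B : ℕ → Set E) (hanti : Antitone B)
    (hcl : ∀ n, IsClosed (B n)) (hcv : ∀ n, Convex ℝ (B n)) (hne : ∀ n, (B n).Nonempty)
    (hbd : Bornology.IsBounded (B 0)) : ∃ x, ∀ n, x ∈ B n := by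
  have hmin : ∀ n, ∃ a ∈ B n, ∀ w ∈ B n, ‖a‖ ^ 2 + ‖w - a‖ ^ 2 ≤ ‖w‖ ^ 2 := by
    intro n
    obtain ⟨a, ha, h⟩ := exists_norm_eq_iInf_of_complete_convex (hne n) (hcl n).isComplete (hcv n) 0
    refine ⟨a, ha, fun w hw => ?_⟩
    have h1 := (norm_eq_iInf_iff_real_inner_le_zero (hcv n) ha).1 h w hw
    have h2 := norm_add_sq_real a (w - a)
    rw [add_sub_cancel] at h2
    rw [zero_sub, inner_neg_left] at h1
    linarith
  choose a ha hmin using hmin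
  obtain ⟨R, hR⟩ := hbd.exists_norm_le
  have hle : ∀ {i j : ℕ}, i ≤ j → ‖a j - a i‖ ^ 2 ≤ ‖a j‖ ^ 2 - ‖a i‖ ^ 2 := by
    intro i j hij
    linarith [hmin i (a j) (hanti hij (ha j))]
  have hmono : Monotone fun n => ‖a n‖ ^ 2 := by
    intro i j hij
    have := hle hij
    have := sq_nonneg ‖a j - a i‖
    show ‖a i‖ ^ 2 ≤ ‖a j‖ ^ 2
    linarith
  have hbdd : BddAbove (Set.range fun n => ‖a n‖ ^ 2) := by
    refine ⟨R ^ 2, ?_⟩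
    rintro _ ⟨n, rfl⟩
    exact pow_le_pow_left₀ (norm_nonneg _) (hR _ (hanti (Nat.zero_le n) (ha n))) 2
  have hcau : CauchySeq fun n => ‖a n‖ ^ 2 :=
    (tendsto_atTop_ciSup hmono hbdd).cauchySeq
  have hca : CauchySeq a := by
    rw [Metric.cauchySeq_iff'] at hcau ⊢
    intro ε hε
    obtain ⟨N, hN⟩ := hcau (ε ^ 2) (by positivity)
    refine ⟨N, fun n hn => ?_⟩
    have h1 := hN n hn
    rw [Real.dist_eq] at h1
    have h2 := hle hn
    rw [dist_eq_norm]
    exact lt_of_pow_lt_pow_left₀ 2 hε.le (by linarith [le_abs_self (‖a n‖ ^ 2 - ‖a N‖ ^ 2)])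
  obtain ⟨x, hx⟩ := cauchySeq_tendsto_of_complete hca
  refine ⟨x, fun n => (hcl n).mem_of_tendsto hx ?_⟩
  filter_upwards [eventually_ge_atTop n] with k hk using hanti hk (ha k)

theorem ConvexFun.convex_le {E : Type*} [AddCommGroup E] [Module ℝ E] {f : E → EReal}
    (hf : ConvexFun f) (a : ℝ) : Convex ℝ {x | f x ≤ (a : EReal)} := by
  intro x hx y hy s t hs ht hst
  have := hf (show (x, a) ∈ {q : E × ℝ | f q.1 ≤ (q.2 : EReal)} from hx)
    (show (y, a) ∈ {q : E × ℝ | f q.1 ≤ (q.2 : EReal)} from hy) hs ht hst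
  simpa [← add_mul, hst] using this

/-- The sublevel sets in `M` at levels strictly decreasing to the infimum are nested, bounded,
closed, convex and nonempty; a common point attains the infimum. -/
theorem exists_isOptimal [CompleteSpace E] {f : E → EReal} (hcv : ConvexFun f)
    (hco : CoerciveFun f) (hlsc : LowerSemicontinuous f) {M : Set E} (hM : Convex ℝ M)
    (hMc : IsClosed M) (hne : ∃ x ∈ M, f x < ⊤) : ∃ x, IsOptimal f M x := by
  obtain ⟨x1, hx1, hx1'⟩ := hne
  have hI : (⨅ x ∈ M, f x) < ⊤ := (iInf₂_le x1 hx1).trans_lt hx1'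
  obtain ⟨u, hu, humem, hut⟩ := exists_seq_strictAnti_tendsto' hI
  have hreal : ∀ n, ∃ r : ℝ, u n = r := by
    intro n
    exact ⟨(u n).toReal, (EReal.coe_toReal (humem n).2.ne
      ((bot_le.trans_lt (humem n).1).ne')).symm⟩
  choose r hr using hreal
  obtain ⟨x, hx⟩ := exists_mem_forall_of_antitone (fun n => M ∩ {x | f x ≤ (r n : EReal)})
    (fun i j hij x hx => ⟨hx.1, (Set.mem_ofPred.1 hx.2).trans (by
      rw [← hr, ← hr]; exact hu.antitone hij)⟩)
    (fun n => hMc.inter (hlsc.isClosed_preimage _))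
    (fun n => hM.inter (hcv.convex_le _))
    (fun n => by
      have h := (humem n).1
      rw [iInf_lt_iff] at h
      obtain ⟨y, hy⟩ := h
      rw [iInf_lt_iff] at hy
      obtain ⟨hyM, hy⟩ := hy
      exact ⟨y, hyM, by rw [Set.mem_ofPred_eq, ← hr]; exact hy.le⟩)
    ((hco _).subset Set.inter_subset_right)
  refine ⟨x, (hx 0).1, fun y hy => ?_⟩
  have : f x ≤ ⨅ x ∈ M, f x :=
    ge_of_tendsto' hut fun n => by rw [hr]; exact (hx n).2
  exact this.trans (iInf₂_le y hy)

theorem exists_real_le [CompleteSpace E] {f : E → EReal} (hbot : ∀ x, f x ≠ ⊥)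
    (hcv : ConvexFun f) (hco : CoerciveFun f) (hlsc : LowerSemicontinuous f) :
    ∃ c : ℝ, ∀ x, (c : EReal) ≤ f x := by
  by_cases h : ∃ x, f x < ⊤
  · obtain ⟨x, hx⟩ := h
    obtain ⟨x0, -, h0⟩ := exists_isOptimal hcv hco hlsc convex_univ isClosed_univ
      ⟨x, Set.mem_univ _, hx⟩
    refine ⟨(f x0).toReal, fun y => ?_⟩
    rw [EReal.coe_toReal ((h0 x trivial).trans_lt hx).ne (hbot x0)]
    exact h0 y trivial
  · push Not at h
    exact ⟨0, fun x => le_top.trans (h x)⟩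

theorem lt_top_of_mem_interior {E : Type*} [NormedAddCommGroup E] {f : E → EReal} {x : E} (hx : x ∈ interior (effDom f)) : f x < ⊤ :=
  (interior_subset hx : x ∈ effDom f)

/-- Baire category: the closed sets `Uᶜ ∪ {f ≤ n}` cover the space, so `f` is bounded above on some
nonempty open subset of `U`. This supplies the open convex set needed for separation. -/
theorem interior_epigraph_nonempty {E : Type*} [NormedAddCommGroup E] [CompleteSpace E]
    {f : E → EReal} (hlsc : LowerSemicontinuous f) (hbot : ∀ x, f x ≠ ⊥)
    (hint : (interior (effDom f)).Nonempty) :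
    (interior {q : E × ℝ | f q.1 ≤ (q.2 : EReal)}).Nonempty := by
  set U := interior (effDom f)
  have hd : Dense (⋃ n : ℕ, interior (Uᶜ ∪ {x | f x ≤ ((n : ℝ) : EReal)})) := by
    refine dense_iUnion_interior_of_closed
      (fun n => isOpen_interior.isClosed_compl.union (hlsc.isClosed_preimage _)) ?_
    rw [Set.eq_univ_iff_forall]
    intro x
    by_cases hx : x ∈ U
    · have hxt : f x < ⊤ := lt_top_of_mem_interior hx
      obtain ⟨n, hn⟩ := exists_nat_ge (f x).toReal
      refine Set.mem_iUnion.2 ⟨n, Or.inr ?_⟩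
      rw [Set.mem_ofPred_eq, ← EReal.coe_toReal hxt.ne (hbot x)]
      exact_mod_cast hn
    · exact Set.mem_iUnion.2 ⟨0, Or.inl hx⟩
  obtain ⟨x, hxU, hx⟩ := hd.inter_open_nonempty U isOpen_interior hint
  obtain ⟨n, hn⟩ := Set.mem_iUnion.1 hx
  refine ⟨(x, (n : ℝ) + 1), mem_interior.2
    ⟨(U ∩ interior (Uᶜ ∪ {x | f x ≤ ((n : ℝ) : EReal)})) ×ˢ Set.Ioi (n : ℝ), ?_,
      (isOpen_interior.inter isOpen_interior).prod isOpen_Ioi, ⟨hxU, hn⟩, by simp⟩⟩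
  rintro ⟨y, s⟩ ⟨⟨hyU, hy⟩, hs⟩
  have := (interior_subset hy).resolve_left (fun h => h hyU)
  exact (Set.mem_ofPred.1 this).trans (by exact_mod_cast (Set.mem_Ioi.1 hs).le)

/-- First-order optimality: at a minimizer over a convex set that meets the interior of the
effective domain there is a subgradient whose negative is normal to the set. -/
theorem IsOptimal.exists_subgradient [CompleteSpace E] {f : E → EReal} (hbot : ∀ x, f x ≠ ⊥)
    (hcv : ConvexFun f) (hlsc : LowerSemicontinuous f) {M : Set E} (hM : Convex ℝ M)
    (hMi : (M ∩ interior (effDom f)).Nonempty) {x0 : E} (h0 : IsOptimal f M x0) :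
    ∃ u : E, (∀ y, f x0 + ((inner ℝ u (y - x0) : ℝ) : EReal) ≤ f y) ∧
      ∀ y ∈ M, 0 ≤ inner ℝ u (y - x0) := by
  obtain ⟨xb, hxbM, hxbi⟩ := hMi
  have hx0 : f x0 < ⊤ := (h0.2 xb hxbM).trans_lt (lt_top_of_mem_interior hxbi)
  set r0 := (f x0).toReal with hr0
  have hfr : f x0 = (r0 : EReal) := (EReal.coe_toReal hx0.ne (hbot x0)).symm
  set S : Set (E × ℝ) := {q : E × ℝ | f q.1 ≤ (q.2 : EReal)} with hS
  have hSi : (interior S).Nonempty := interior_epigraph_nonempty hlsc hbot ⟨xb, hxbi⟩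
  have hSc : Convex ℝ S := hcv
  have hstrict : ∀ q ∈ interior S, f q.1 < (q.2 : EReal) := by
    intro q hq
    have hcont : Tendsto (fun d : ℝ => (q.1, q.2 - d)) (𝓝 0) (𝓝 q) := by
      have : Continuous (fun d : ℝ => (q.1, q.2 - d)) := by fun_prop
      simpa using this.tendsto 0
    have h1 := (hcont.eventually (mem_interior_iff_mem_nhds.1 hq)).filter_mono
      (nhdsWithin_le_nhds (s := Set.Ioi 0))
    obtain ⟨d, hd, hd0⟩ := (h1.and self_mem_nhdsWithin).exists
    refine (show f q.1 ≤ ((q.2 - d : ℝ) : EReal) from hd).trans_lt ?_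
    exact_mod_cast sub_lt_self _ hd0
  have hdisj : Disjoint (interior S) (M ×ˢ Set.Iic r0) := by
    rw [Set.disjoint_left]
    rintro q hq ⟨hqM, hqr⟩
    have h1 := (h0.2 _ hqM).trans_lt (hstrict q hq)
    rw [hfr] at h1
    exact absurd (EReal.coe_lt_coe_iff.1 h1) (not_lt.2 hqr)
  -- Optimality keeps the interior of the epigraph off `M × (-∞, r0]`; the separating functional,
  -- divided by its vertical slope, will be the subgradient.
  obtain ⟨F, s, hF1, hF2⟩ := geometric_hahn_banach_open hSc.interior isOpen_interior
    (hM.prod (convex_Iic r0)) hdisj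
  have hF1' : ∀ q ∈ S, F q ≤ s := by
    intro q hq
    have h1 : q ∈ closure (interior S) := by
      rw [hSc.closure_interior_eq_closure_of_nonempty_interior hSi]
      exact subset_closure hq
    exact closure_minimal (fun a ha => (hF1 a ha).le)
      (isClosed_le F.continuous continuous_const) h1
  set c := F (0, 1) with hc
  have hFd : ∀ x r, F (x, r) = F (x, 0) + r * c := by
    intro x r
    have : ((x, r) : E × ℝ) = (x, 0) + r • (0, 1) := by simp
    rw [this, map_add, map_smul, smul_eq_mul]
  obtain ⟨⟨x1, r1⟩, hq1⟩ := hSi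
  have hc0 : c < 0 := by
    -- a point of the interior of the epigraph above `xb`
    have hcont : Tendsto (fun d : ℝ => xb + d • (xb - x1)) (𝓝 0) (𝓝 xb) := by
      have : Continuous (fun d : ℝ => xb + d • (xb - x1)) := by fun_prop
      simpa using this.tendsto 0
    have h1 := (hcont.eventually (isOpen_interior.mem_nhds hxbi)).filter_mono
      (nhdsWithin_le_nhds (s := Set.Ioi 0))
    obtain ⟨d, hd, hd0⟩ := (h1.and self_mem_nhdsWithin).exists
    have hd0 : 0 < d := hd0
    have hlt : f (xb + d • (xb - x1)) < ⊤ := lt_top_of_mem_interior hd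
    have hmem : (xb + d • (xb - x1), (f (xb + d • (xb - x1))).toReal) ∈ S := by
      show f _ ≤ _
      rw [EReal.coe_toReal hlt.ne (hbot _)]
    -- The segment from the interior point `(x1, r1)` to a graph point slightly beyond `xb` passes
    -- over `xb`, and does so in the interior of the epigraph.
    have hcomb := hSc.combo_interior_self_subset_interior (a := d / (1 + d)) (b := 1 / (1 + d))
      (by positivity) (by positivity) (by field_simp; ring)
      (Set.add_mem_add (Set.smul_mem_smul_set hq1) (Set.smul_mem_smul_set hmem))
    have hxb : (d / (1 + d)) • x1 + (1 / (1 + d)) • (xb + d • (xb - x1)) = xb := by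
      have : (1 + d) ≠ 0 := by positivity
      rw [show xb + d • (xb - x1) = (1 + d) • xb - d • x1 by module, smul_sub, smul_smul, smul_smul,
        one_div_mul_cancel this, one_smul, one_div, div_eq_inv_mul]
      abel
    simp only [Prod.smul_mk, Prod.mk_add_mk, hxb] at hcomb
    -- That point is strictly higher than `r0` and `F` is strictly smaller there than at `(xb, r0)`,
    -- so the hyperplane is not vertical.
    have h3 := hF1 _ hcomb
    have h4 := hstrict _ hcomb
    have h5 := hF2 (xb, r0) ⟨hxbM, Set.mem_Iic.2 le_rfl⟩
    rw [hFd] at h3 h5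
    have h6 := (h0.2 xb hxbM).trans_lt h4
    rw [hfr] at h6
    have h6 := EReal.coe_lt_coe_iff.1 h6
    by_contra hcon
    push Not at hcon
    nlinarith
  have hx0S : (x0, r0) ∈ S := by show f x0 ≤ _; rw [hfr]
  have hs : s = F (x0, r0) :=
    le_antisymm (hF2 _ ⟨h0.1, Set.mem_Iic.2 le_rfl⟩) (hF1' _ hx0S)
  set G : StrongDual ℝ E := F.comp (ContinuousLinearMap.inl ℝ E ℝ) with hG
  have hGF : ∀ x, F (x, 0) = G x := fun x => rfl
  refine ⟨(InnerProductSpace.toDual ℝ E).symm ((-c)⁻¹ • G), fun y => ?_, fun y hy => ?_⟩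
  · by_cases hy : f y = ⊤
    · rw [hy]; exact le_top
    have hyr : f y = ((f y).toReal : EReal) := (EReal.coe_toReal hy (hbot y)).symm
    have h1 := hF1' (y, (f y).toReal) (by show f y ≤ _; rw [← hyr])
    rw [hs, hFd, hFd x0, hGF, hGF] at h1
    rw [hyr, hfr, InnerProductSpace.toDual_symm_apply, ← EReal.coe_add, EReal.coe_le_coe_iff,
      smul_apply, map_sub, smul_eq_mul]
    have h2 : (-c)⁻¹ * (G y - G x0) ≤ (-c)⁻¹ * ((-c) * ((f y).toReal - r0)) := by
      apply mul_le_mul_of_nonneg_left _ (by simpa using hc0.le)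
      linarith
    rw [inv_mul_cancel_left₀ (by linarith)] at h2
    linarith
  · have h1 := hF2 (y, r0) ⟨hy, Set.mem_Iic.2 le_rfl⟩
    rw [hs, hFd, hFd y, hGF, hGF] at h1
    rw [InnerProductSpace.toDual_symm_apply, smul_apply, map_sub, smul_eq_mul]
    exact mul_nonneg (by simpa using hc0.le) (by linarith)

/-- If the conjugate is Fréchet differentiable at `u` and `u` is a subgradient at `x0`, then `x0`
is the strong minimizer of the function tilted by `u`. -/
theorem exists_pos_forall_norm_sub_le {f : E → EReal} (hbot : ∀ x, f x ≠ ⊥) {x0 u : E}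
    (hx0 : f x0 < ⊤)
    (hu : ∀ y, f x0 + ((inner ℝ u (y - x0) : ℝ) : EReal) ≤ f y)
    (hdiff : (subdiff (conjugate f) u).Nonempty → FrechetDifferentiableAt (conjugate f) u)
    {η : ℝ} (hη : 0 < η) :
    ∃ ε > 0, ∀ z, f z ≤ f x0 + ((inner ℝ u (z - x0) + ε : ℝ) : EReal) → ‖z - x0‖ ≤ η := by
  set r0 := (f x0).toReal with hr0
  have hfr : f x0 = (r0 : EReal) := (EReal.coe_toReal hx0.ne (hbot x0)).symm
  have hlow : ∀ v z (r : ℝ), f z ≤ (r : EReal) →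
      ((inner ℝ v z - r : ℝ) : EReal) ≤ conjugate f v := by
    intro v z r hz
    refine le_trans ?_ (le_iSup _ z)
    rw [EReal.coe_sub]
    exact EReal.sub_le_sub le_rfl hz
  have hval : conjugate f u = ((inner ℝ u x0 - r0 : ℝ) : EReal) := by
    refine le_antisymm (iSup_le fun y => ?_) (hlow u x0 r0 hfr.le)
    by_cases hy : f y = ⊤
    · rw [hy, EReal.sub_top]; exact bot_le
    have h1 := hu y
    rw [← EReal.coe_toReal hy (hbot y), hfr, ← EReal.coe_add, EReal.coe_le_coe_iff,
      inner_sub_right] at h1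
    rw [← EReal.coe_toReal hy (hbot y), ← EReal.coe_sub, EReal.coe_le_coe_iff]
    linarith
  obtain ⟨hfin, hd⟩ := hdiff ⟨x0, by rw [hval]; exact EReal.coe_lt_top _, fun v => by
    rw [hval, ← EReal.coe_add]
    convert hlow v x0 r0 hfr.le using 2
    rw [inner_sub_right, real_inner_comm x0 v, real_inner_comm x0 u]
    ring⟩
  set g : E → ℝ := fun v => (conjugate f v).toReal with hg
  have hgu : g u = inner ℝ u x0 - r0 := by
    simp only [hg, hval, EReal.toReal_coe]
  have hglow : ∀ᶠ v in 𝓝 u, ∀ z (r : ℝ), f z ≤ (r : EReal) → inner ℝ v z - r ≤ g v := by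
    filter_upwards [hfin] with v hv z r hz
    have := hlow v z r hz
    rwa [← EReal.coe_toReal hv.1 hv.2, EReal.coe_le_coe_iff] at this
  have hder : HasFDerivAt (fun v => g v - innerSL ℝ x0 v) (fderiv ℝ g u - innerSL ℝ x0) u :=
    hd.hasFDerivAt.sub (innerSL ℝ x0).hasFDerivAt
  -- Near `u`, `g v ≥ ⟨v, x0⟩ - r0` with equality at `u`, so the derivative of `g` at `u` must be
  -- `⟨x0, ·⟩`.
  have hmin : IsLocalMin (fun v => g v - innerSL ℝ x0 v) u := by
    filter_upwards [hglow] with v hv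
    have := hv x0 r0 hfr.le
    simp only [innerSL_apply_apply]
    rw [hgu, real_inner_comm v x0, real_inner_comm u x0]
    linarith
  rw [hmin.hasFDerivAt_eq_zero hder] at hder
  have hlo := (hasFDerivAt_iff_isLittleO_nhds_zero.1 hder).def (half_pos hη)
  have hshift : Tendsto (fun h : E => u + h) (𝓝 0) (𝓝 u) := by
    have : Continuous (fun h : E => u + h) := by fun_prop
    simpa using this.tendsto 0
  obtain ⟨t, ht, hball⟩ := Metric.eventually_nhds_iff.1 (hlo.and (hshift.eventually hglow))
  -- With `h` of length `t / 2` in the direction `z - x0`, Fenchel's inequality at `u + h` and the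
  -- first-order expansion give `⟨h, z - x0⟩ ≤ ε + (η / 2) ‖h‖`. This `ε` equals `(η / 2) ‖h‖`,
  -- whence `‖z - x0‖ ≤ η`.
  refine ⟨t / 2 * (η / 2), by positivity, fun z hz => ?_⟩
  by_contra! hcon
  have hn : 0 < ‖z - x0‖ := hη.trans hcon
  set h : E := (t / 2 / ‖z - x0‖) • (z - x0) with hh
  have hnorm : ‖h‖ = t / 2 := by
    rw [hh, norm_smul, Real.norm_of_nonneg (by positivity), div_mul_cancel₀ _ hn.ne']
  obtain ⟨h1, h2⟩ := @hball h (by rw [dist_zero_right, hnorm]; linarith)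
  rw [hfr, ← EReal.coe_add] at hz
  have h3 := h2 z _ hz
  have h4 := (le_abs_self _).trans h1
  simp only [innerSL_apply_apply, zero_apply, sub_zero, hgu, hnorm] at h4
  have h5 : inner ℝ h (z - x0) = t / 2 * ‖z - x0‖ := by
    rw [hh, real_inner_smul_left, real_inner_self_eq_norm_sq]
    field_simp
  rw [inner_sub_right] at h5 h3
  rw [inner_add_left] at h3
  rw [inner_add_right, real_inner_comm u x0, real_inner_comm h x0] at h4
  nlinarith

end Hilbert

/-! ### Moreau envelopes: order, convexity, continuity, coercivity -/

section Moreau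

variable {E : Type*} [NormedAddCommGroup E]

/-- The slack `ε` is there because the infimum need not be attained; moving the quadratic term to
the real side avoids extended-real arithmetic afterwards. -/
theorem moreauEnvelope_le_iff {f : E → EReal} {l : ℝ} {x : E} {r : ℝ} :
    moreauEnvelope f l x ≤ (r : EReal) ↔
      ∀ ε > 0, ∃ z, f z ≤ ((r + ε - 1 / (2 * l) * ‖x - z‖ ^ 2 : ℝ) : EReal) := by
  constructor
  · intro h ε hε
    have h1 : moreauEnvelope f l x < ((r + ε : ℝ) : EReal) :=
      h.trans_lt (by exact_mod_cast lt_add_of_pos_right r hε)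
    obtain ⟨z, hz⟩ := iInf_lt_iff.1 h1
    refine ⟨z, ?_⟩
    rw [EReal.coe_sub, EReal.le_sub_iff_add_le (.inl (EReal.coe_ne_bot _))
      (.inl (EReal.coe_ne_top _))]
    exact hz.le
  · intro h
    refine EReal.le_of_forall_lt_iff_le.1 fun s hs => ?_
    have hs : r < s := by exact_mod_cast hs
    obtain ⟨z, hz⟩ := h (s - r) (sub_pos.2 hs)
    refine (iInf_le _ z).trans ?_
    rw [EReal.coe_sub, EReal.le_sub_iff_add_le (.inl (EReal.coe_ne_bot _))
      (.inl (EReal.coe_ne_top _)), add_sub_cancel] at hz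
    exact hz

theorem moreauEnvelope_le_self (f : E → EReal) (l : ℝ) (x : E) : moreauEnvelope f l x ≤ f x :=
  (iInf_le _ x).trans (by simp)

theorem moreauEnvelope_lt_top {f : E → EReal} {l : ℝ} {z : E} (hz : f z < ⊤) (x : E) :
    moreauEnvelope f l x < ⊤ :=
  (iInf_le _ z).trans_lt (EReal.add_lt_top hz.ne (EReal.coe_ne_top _))

theorem moreauEnvelope_anti (f : E → EReal) {l l' : ℝ} (hl : 0 < l) (hll : l ≤ l') (x : E) :
    moreauEnvelope f l' x ≤ moreauEnvelope f l x := by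
  refine iInf_mono fun z => ?_
  gcongr

theorem le_moreauEnvelope {f : E → EReal} {c : ℝ} (hc : ∀ x, (c : EReal) ≤ f x) {l : ℝ}
    (hl : 0 < l) (x : E) : (c : EReal) ≤ moreauEnvelope f l x := by
  refine le_iInf fun z => ?_
  calc (c : EReal) = c + 0 := (add_zero _).symm
    _ ≤ _ := add_le_add (hc z) (by exact_mod_cast (by positivity : 0 ≤ 1 / (2 * l) * ‖x - z‖ ^ 2))

theorem norm_sq_combo_le [NormedSpace ℝ E] {a b : ℝ} (ha : 0 ≤ a) (hb : 0 ≤ b) (hab : a + b = 1)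
    (x y : E) : ‖a • x + b • y‖ ^ 2 ≤ a * ‖x‖ ^ 2 + b * ‖y‖ ^ 2 :=
  ((convexOn_norm convex_univ).pow (fun _ _ => norm_nonneg _) 2).2 trivial trivial ha hb hab

theorem ConvexFun.moreauEnvelope [NormedSpace ℝ E] {f : E → EReal} (hf : ConvexFun f) {l : ℝ}
    (hl : 0 < l) : ConvexFun (moreauEnvelope f l) := by
  rintro ⟨x, r⟩ hx ⟨y, s⟩ hy a b ha hb hab
  refine moreauEnvelope_le_iff.2 fun ε hε => ?_
  obtain ⟨z, hz⟩ := moreauEnvelope_le_iff.1 hx ε hε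
  obtain ⟨w, hw⟩ := moreauEnvelope_le_iff.1 hy ε hε
  refine ⟨a • z + b • w, (hf (show (z, _) ∈ _ from hz) (show (w, _) ∈ _ from hw)
    ha hb hab : f (a • z + b • w) ≤ _).trans ?_⟩
  have h1 := norm_sq_combo_le ha hb hab (x - z) (y - w)
  have h2 : a • x + b • y - (a • z + b • w) = a • (x - z) + b • (y - w) := by module
  simp only [Prod.smul_mk, Prod.mk_add_mk, smul_eq_mul]
  rw [EReal.coe_le_coe_iff, h2]
  have h3 := mul_le_mul_of_nonneg_left h1 (by positivity : 0 ≤ 1 / (2 * l))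
  have h4 : ε = a * ε + b * ε := by rw [← add_mul, hab, one_mul]
  nlinarith

/-- A finite convex Moreau envelope is continuous. -/
theorem continuous_toReal_moreauEnvelope [NormedSpace ℝ E] {f : E → EReal} (hf : ConvexFun f)
    {l : ℝ} (hl : 0 < l) (hbot : ∀ x, moreauEnvelope f l x ≠ ⊥) (hne : ∃ z, f z < ⊤) :
    Continuous fun x => (moreauEnvelope f l x).toReal := by
  obtain ⟨z, hz⟩ := hne
  have hcoe : ∀ x, ((moreauEnvelope f l x).toReal : EReal) = moreauEnvelope f l x := fun x =>
    EReal.coe_toReal (moreauEnvelope_lt_top hz x).ne (hbot x)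
  have hconv : ConvexOn ℝ Set.univ fun x => (moreauEnvelope f l x).toReal := by
    refine ⟨convex_univ, fun x _ y _ a b ha hb hab => ?_⟩
    have h := hf.moreauEnvelope hl (show (x, _) ∈ _ from (hcoe x).ge)
      (show (y, _) ∈ _ from (hcoe y).ge) ha hb hab
    have h : moreauEnvelope f l (a • x + b • y) ≤ _ := h
    rw [← hcoe] at h
    exact EReal.coe_le_coe_iff.1 h
  have htfae := (hconv.continuousOn_tfae isOpen_univ Set.univ_nonempty).out 1 3
  rw [← continuousOn_univ, htfae]
  refine ⟨z, trivial, ?_⟩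
  have hub : ∀ x, (moreauEnvelope f l x).toReal ≤ (f z).toReal + 1 / (2 * l) * ‖x - z‖ ^ 2 := by
    intro x
    rw [← EReal.coe_le_coe_iff, hcoe, EReal.coe_add]
    exact (iInf_le _ z).trans (add_le_add_left (EReal.le_coe_toReal hz.ne) _)
  have hcont : Continuous fun x => (f z).toReal + 1 / (2 * l) * ‖x - z‖ ^ 2 := by fun_prop
  exact (hcont.tendsto z).isBoundedUnder_le.mono_le (Eventually.of_forall hub)

theorem lowerSemicontinuous_moreauEnvelope [NormedSpace ℝ E] {f : E → EReal} (hf : ConvexFun f)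
    {l : ℝ} (hl : 0 < l) (hbot : ∀ x, moreauEnvelope f l x ≠ ⊥) (hne : ∃ z, f z < ⊤) :
    LowerSemicontinuous (moreauEnvelope f l) := by
  have h := continuous_coe_real_ereal.comp (continuous_toReal_moreauEnvelope hf hl hbot hne)
  obtain ⟨z, hz⟩ := hne
  have heq : (fun r : ℝ => (r : EReal)) ∘ (fun x => (moreauEnvelope f l x).toReal) =
      moreauEnvelope f l := funext fun x =>
    EReal.coe_toReal (moreauEnvelope_lt_top hz x).ne (hbot x)
  rw [heq] at h
  exact h.lowerSemicontinuous

theorem CoerciveFun.moreauEnvelope {f : E → EReal} (hf : CoerciveFun f) {c : ℝ}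
    (hc : ∀ x, (c : EReal) ≤ f x) {l : ℝ} (hl : 0 < l) : CoerciveFun (moreauEnvelope f l) := by
  intro a
  obtain ⟨R, hR⟩ := (hf (a + 1)).exists_norm_le
  -- A near-minimizer `z` with slack `1` lies in the sublevel set at `a + 1`, and `‖x - z‖ ^ 2 ≤ 2 *
  -- l * (a + 1 - c)`; the last `1` in the radius comes from `t ≤ t ^ 2 + 1`.
  refine (Metric.isBounded_closedBall (x := (0 : E))
    (r := R + (2 * l * (a + 1 - c) + 1))).subset fun x hx => ?_
  obtain ⟨z, hz⟩ := moreauEnvelope_le_iff.1 hx 1 one_pos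
  have hq : 0 ≤ 1 / (2 * l) * ‖x - z‖ ^ 2 := by positivity
  have h1 := hR z (hz.trans (by exact_mod_cast sub_le_self _ hq))
  have h2 := EReal.coe_le_coe_iff.1 ((hc z).trans hz)
  have h3 : ‖x - z‖ ^ 2 ≤ 2 * l * (a + 1 - c) := by
    have h4 := mul_le_mul_of_nonneg_left (show 1 / (2 * l) * ‖x - z‖ ^ 2 ≤ a + 1 - c by linarith)
      (by positivity : 0 ≤ 2 * l)
    rwa [← mul_assoc, mul_one_div_cancel (by positivity), one_mul] at h4
  rw [mem_closedBall_zero_iff]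
  calc ‖x‖ = ‖z + (x - z)‖ := by rw [add_sub_cancel]
    _ ≤ ‖z‖ + ‖x - z‖ := norm_add_le _ _
    _ ≤ _ := by nlinarith [sq_nonneg (‖x - z‖ - 1)]

end Moreau

/-! ### Proximal points and subgradients of the envelope -/

section MoreauHilbert

variable {E : Type*} [NormedAddCommGroup E] [InnerProductSpace ℝ E]

/-- Completing the square: the envelope of an affine function with slope `u` lies exactly `l / 2 *
‖u‖ ^ 2` below it. -/
theorem sub_le_moreauEnvelope {f : E → EReal} {x u : E} {r : ℝ}
    (hu : ∀ y, (r : EReal) + ((inner ℝ u (y - x) : ℝ) : EReal) ≤ f y) {l : ℝ} (hl : 0 < l) :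
    ((r - l / 2 * ‖u‖ ^ 2 : ℝ) : EReal) ≤ moreauEnvelope f l x := by
  refine le_iInf fun z => le_trans ?_ (add_le_add_left (hu z) _)
  rw [← EReal.coe_add, ← EReal.coe_add, EReal.coe_le_coe_iff]
  have h1 := norm_add_sq_real (l • u) (z - x)
  rw [norm_smul, real_inner_smul_left, Real.norm_of_nonneg hl.le, ← norm_sub_rev x z] at h1
  have h2 : 0 ≤ 1 / (2 * l) * ‖l • u + (z - x)‖ ^ 2 := by positivity
  rw [h1] at h2
  have h3 : 1 / (2 * l) * ((l * ‖u‖) ^ 2 + 2 * (l * inner ℝ u (z - x)) + ‖x - z‖ ^ 2) =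
      l / 2 * ‖u‖ ^ 2 + inner ℝ u (z - x) + 1 / (2 * l) * ‖x - z‖ ^ 2 := by
    field_simp
  linarith

variable [CompleteSpace E]

theorem exists_moreauEnvelope_eq {f : E → EReal} (hcv : ConvexFun f)
    (hco : CoerciveFun f) (hlsc : LowerSemicontinuous f) (hne : ∃ x, f x < ⊤) {l : ℝ} (hl : 0 < l)
    (x : E) : ∃ z, f z < ⊤ ∧
      moreauEnvelope f l x = f z + ((1 / (2 * l) * ‖x - z‖ ^ 2 : ℝ) : EReal) := by
  obtain ⟨y, hy⟩ := hne
  have hcv' : ConvexFun fun z => f z + ((1 / (2 * l) * ‖x - z‖ ^ 2 : ℝ) : EReal) := by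
    rintro ⟨z, r⟩ hz ⟨w, s⟩ hw a b ha hb hab
    have hz : f z ≤ ((r - 1 / (2 * l) * ‖x - z‖ ^ 2 : ℝ) : EReal) := by
      rwa [EReal.coe_sub, EReal.le_sub_iff_add_le (.inl (EReal.coe_ne_bot _))
        (.inl (EReal.coe_ne_top _))]
    have hw : f w ≤ ((s - 1 / (2 * l) * ‖x - w‖ ^ 2 : ℝ) : EReal) := by
      rwa [EReal.coe_sub, EReal.le_sub_iff_add_le (.inl (EReal.coe_ne_bot _))
        (.inl (EReal.coe_ne_top _))]
    show f (a • z + b • w) + ((1 / (2 * l) * ‖x - (a • z + b • w)‖ ^ 2 : ℝ) : EReal) ≤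
      ((a * r + b * s : ℝ) : EReal)
    rw [← EReal.le_sub_iff_add_le (.inl (EReal.coe_ne_bot _)) (.inl (EReal.coe_ne_top _)),
      ← EReal.coe_sub]
    refine (hcv (show (z, _) ∈ _ from hz) (show (w, _) ∈ _ from hw)
      ha hb hab : f (a • z + b • w) ≤ _).trans ?_
    have h1 := norm_sq_combo_le ha hb hab (x - z) (x - w)
    have h2 : x - (a • z + b • w) = a • (x - z) + b • (x - w) := by
      rw [show a • (x - z) + b • (x - w) = (a + b) • x - (a • z + b • w) by module, hab, one_smul]
    simp only [Prod.smul_mk, Prod.mk_add_mk, smul_eq_mul]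
    rw [EReal.coe_le_coe_iff, h2]
    have h3 := mul_le_mul_of_nonneg_left h1 (by positivity : 0 ≤ 1 / (2 * l))
    linarith
  have hle : ∀ z, f z ≤ f z + ((1 / (2 * l) * ‖x - z‖ ^ 2 : ℝ) : EReal) := fun z =>
    le_add_of_nonneg_right
      (by exact_mod_cast (by positivity : 0 ≤ 1 / (2 * l) * ‖x - z‖ ^ 2))
  have hlsc' : LowerSemicontinuous fun z => f z + ((1 / (2 * l) * ‖x - z‖ ^ 2 : ℝ) : EReal) := by
    refine hlsc.add' (Continuous.lowerSemicontinuous ?_) fun z =>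
      EReal.continuousAt_add (.inr (EReal.coe_ne_bot _)) (.inr (EReal.coe_ne_top _))
    exact continuous_coe_real_ereal.comp (by fun_prop)
  obtain ⟨z, -, hz⟩ := exists_isOptimal hcv' (fun a => (hco a).subset fun z hz => (hle z).trans hz)
    hlsc' convex_univ isClosed_univ
    ⟨y, trivial, EReal.add_lt_top hy.ne (EReal.coe_ne_top _)⟩
  refine ⟨z, (hle z).trans_lt ((hz y trivial).trans_lt
    (EReal.add_lt_top hy.ne (EReal.coe_ne_top _))), ?_⟩
  exact le_antisymm (iInf_le _ z) (le_iInf fun w => hz w trivial)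

/-- A subgradient `u` of the Moreau envelope at `x` is a subgradient of `f` at the proximal point
`x - l • u`. -/
theorem subgradient_of_moreauEnvelope {f : E → EReal} (hbot : ∀ x, f x ≠ ⊥) (hcv : ConvexFun f)
    (hco : CoerciveFun f) (hlsc : LowerSemicontinuous f) (hne : ∃ x, f x < ⊤) {l : ℝ} (hl : 0 < l)
    {x u : E} (hu : ∀ y, moreauEnvelope f l x + ((inner ℝ u (y - x) : ℝ) : EReal) ≤
      moreauEnvelope f l y) :
    f (x - l • u) < ⊤ ∧
      ∀ y, f (x - l • u) + ((inner ℝ u (y - (x - l • u)) : ℝ) : EReal) ≤ f y := by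
  obtain ⟨z, hz, hxz⟩ := exists_moreauEnvelope_eq hcv hco hlsc hne hl x
  have hfz : f z = ((f z).toReal : EReal) := (EReal.coe_toReal hz.ne (hbot z)).symm
  have key : ∀ w y, f y < ⊤ → (f z).toReal + 1 / (2 * l) * ‖x - z‖ ^ 2 + inner ℝ u (w - x) ≤
      (f y).toReal + 1 / (2 * l) * ‖w - y‖ ^ 2 := by
    intro w y hy
    have h := (hu w).trans (iInf_le _ y)
    rw [hxz, hfz, ← EReal.coe_toReal hy.ne (hbot y)] at h
    exact_mod_cast h
  -- The choice `w = z + l • u`, `y = z` in `key` leaves `‖x - z - l • u‖ ^ 2 ≤ 0`.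
  have hzu : x - l • u = z := by
    have h1 := key (z + l • u) z hz
    have h2 := norm_sub_sq_real (x - z) (l • u)
    rw [add_sub_cancel_left, norm_smul, Real.norm_of_nonneg hl.le,
      show z + l • u - x = l • u - (x - z) by abel, inner_sub_right, real_inner_smul_right,
      real_inner_self_eq_norm_sq] at h1
    rw [norm_smul, Real.norm_of_nonneg hl.le, real_inner_smul_right, real_inner_comm] at h2
    have h3 : 1 / (2 * l) * ‖x - z‖ ^ 2 + (l * ‖u‖ ^ 2 - inner ℝ u (x - z)) -
        1 / (2 * l) * (l * ‖u‖) ^ 2 = 1 / (2 * l) * ‖x - z - l • u‖ ^ 2 := by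
      rw [h2]; field_simp; ring
    have h4 : 1 / (2 * l) * ‖x - z - l • u‖ ^ 2 ≤ 0 := by linarith
    have h5 : ‖x - z - l • u‖ = 0 := by
      by_contra hcon
      have : 0 < ‖x - z - l • u‖ := lt_of_le_of_ne (norm_nonneg _) (Ne.symm hcon)
      have : 0 < 1 / (2 * l) * ‖x - z - l • u‖ ^ 2 := by positivity
      linarith
    rw [norm_eq_zero] at h5
    rw [sub_right_comm] at h5
    exact sub_eq_zero.1 h5
  rw [hzu]
  refine ⟨hz, fun y => ?_⟩
  by_cases hy : f y = ⊤
  · rw [hy]; exact le_top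
  -- Translating `w` along with `y` makes the two quadratic terms cancel.
  have h := key (y + (x - z)) y (lt_top_iff_ne_top.2 hy)
  rw [add_sub_cancel_left, show y + (x - z) - x = y - z by abel] at h
  rw [hfz, ← EReal.coe_toReal hy (hbot y), ← EReal.coe_add, EReal.coe_le_coe_iff]
  linarith

end MoreauHilbert

set_option linter.unusedSectionVars false

/-! ### Generalized means and probabilities of sections of a closed convex set -/

section Sections

theorem min_le_genMean {α : EReal} {a b t : ℝ} (ha : 0 < a) (hb : 0 < b)
    (ht : t ∈ Set.Icc (0 : ℝ) 1) : min a b ≤ genMean α a b t := by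
  have ht0 : 0 ≤ t := ht.1
  have ht1 : 0 ≤ 1 - t := sub_nonneg.2 ht.2
  have hm : 0 < min a b := lt_min ha hb
  rw [genMean, if_neg (mul_pos ha hb).ne']
  split_ifs with h0 h1 h2
  · calc min a b = min a b ^ t * min a b ^ (1 - t) := by
          rw [← Real.rpow_add hm, add_sub_cancel, Real.rpow_one]
      _ ≤ a ^ t * b ^ (1 - t) := mul_le_mul
          (Real.rpow_le_rpow hm.le (min_le_left a b) ht0)
          (Real.rpow_le_rpow hm.le (min_le_right a b) ht1) (by positivity) (by positivity)
  · exact min_le_max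
  · exact le_rfl
  · have hα : α.toReal ≠ 0 := by
      intro h
      rw [← EReal.coe_toReal h1 h2, h] at h0
      exact h0 rfl
    have hself : (min a b ^ α.toReal) ^ (1 / α.toReal) = min a b := by
      rw [← Real.rpow_mul hm.le, mul_one_div_cancel hα, Real.rpow_one]
    rcases hα.lt_or_gt with hneg | hpos
    · have hpa := Real.rpow_le_rpow_of_nonpos hm (min_le_left a b) hneg.le
      have hpb := Real.rpow_le_rpow_of_nonpos hm (min_le_right a b) hneg.le
      have hpos' : 0 < t * a ^ α.toReal + (1 - t) * b ^ α.toReal := by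
        have h3 : 0 < a ^ α.toReal := by positivity
        have h4 : 0 < b ^ α.toReal := by positivity
        rcases ht0.eq_or_lt with h5 | h5
        · rw [← h5]; simpa using h4
        · have := mul_pos h5 h3
          have := mul_nonneg ht1 h4.le
          linarith
      conv_lhs => rw [← hself]
      exact Real.rpow_le_rpow_of_nonpos hpos'
        (by nlinarith) (one_div_nonpos.2 hneg.le)
    · have hpa := Real.rpow_le_rpow hm.le (min_le_left a b) hpos.le
      have hpb := Real.rpow_le_rpow hm.le (min_le_right a b) hpos.le
      conv_lhs => rw [← hself]
      exact Real.rpow_le_rpow (by positivity) (by nlinarith) (one_div_nonneg.2 hpos.le)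

variable {H : Type*} [NormedAddCommGroup H] {Ω : Type*} [MeasurableSpace Ω] {m : ℕ}

/-- The probability that `(x, ξ)` lies in `F`. -/
def sectionProb (P : Measure Ω) (ξ : Ω → EuclideanSpace ℝ (Fin m))
    (F : Set (WithLp 2 (H × EuclideanSpace ℝ (Fin m)))) (x : H) : ℝ :=
  P.real {ω | WithLp.toLp 2 (x, ξ ω) ∈ F}

variable {P : Measure Ω} {ξ : Ω → EuclideanSpace ℝ (Fin m)}
  {F : Set (WithLp 2 (H × EuclideanSpace ℝ (Fin m)))}

theorem measurableSet_section (hF : IsClosed F) (x : H) :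
    MeasurableSet {z : EuclideanSpace ℝ (Fin m) | WithLp.toLp 2 (x, z) ∈ F} :=
  (hF.preimage ((WithLp.prod_continuous_toLp 2 H (EuclideanSpace ℝ (Fin m))).comp
    (by fun_prop : Continuous fun z => (x, z)))).measurableSet

theorem sectionProb_eq (hξ : Measurable ξ) (hF : IsClosed F) (x : H) :
    sectionProb P ξ F x = (P.map ξ).real {z | WithLp.toLp 2 (x, z) ∈ F} :=
  (map_measureReal_apply hξ (measurableSet_section hF x)).symm

theorem sectionProb_mono [IsFiniteMeasure P]
    {F' : Set (WithLp 2 (H × EuclideanSpace ℝ (Fin m)))} (h : F ⊆ F') (x : H) :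
    sectionProb P ξ F x ≤ sectionProb P ξ F' x :=
  measureReal_mono fun _ hω => h hω

/-- Reverse Fatou: if `x n → a`, the upper limit of the events `(x n, ξ) ∈ F` has probability at
least `p`, being the decreasing limit of the tail unions `T N`. It is contained in the event `(a, ξ)
∈ F` because `F` is closed. -/
theorem isClosed_le_sectionProb [IsFiniteMeasure P] (hξ : Measurable ξ) (hF : IsClosed F) (p : ℝ) :
    IsClosed {x | p ≤ sectionProb P ξ F x} := by
  refine IsSeqClosed.isClosed fun x a hx hxa => ?_
  set T : ℕ → Set Ω := fun N => ⋃ n ≥ N, {ω | WithLp.toLp 2 (x n, ξ ω) ∈ F} with hT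
  have hmeas : ∀ n, MeasurableSet {ω | WithLp.toLp 2 (x n, ξ ω) ∈ F} := fun n =>
    hξ (measurableSet_section hF (x n))
  have hTm : ∀ N, MeasurableSet (T N) := fun N =>
    MeasurableSet.iUnion fun n => MeasurableSet.iUnion fun _ => hmeas n
  have hanti : Antitone T := fun i j hij =>
    Set.iUnion_mono fun n => Set.iUnion_subset fun hn =>
      Set.subset_iUnion_of_subset (hij.trans hn) subset_rfl
  have hlim := tendsto_measure_iInter_atTop (μ := P) (fun N => (hTm N).nullMeasurableSet) hanti
    ⟨0, measure_ne_top _ _⟩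
  have hlim' := (ENNReal.tendsto_toReal (measure_ne_top P (⋂ n, T n))).comp hlim
  have h1 : p ≤ P.real (⋂ n, T n) := by
    refine ge_of_tendsto' hlim' fun N => (hx N).trans ?_
    exact measureReal_mono (Set.subset_iUnion₂_of_subset N (le_refl N) subset_rfl)
      (measure_ne_top P _)
  refine h1.trans (measureReal_mono fun ω hω => ?_)
  have hfreq : ∃ᶠ n in atTop, WithLp.toLp 2 (x n, ξ ω) ∈ F := by
    rw [frequently_atTop]
    intro N
    obtain ⟨n, hn⟩ := Set.mem_iUnion.1 (Set.mem_iInter.1 hω N)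
    obtain ⟨hn, h⟩ := Set.mem_iUnion.1 hn
    exact ⟨n, hn, h⟩
  have hcont : Tendsto (fun n => WithLp.toLp 2 (x n, ξ ω)) atTop
      (𝓝 (WithLp.toLp 2 (a, ξ ω))) :=
    ((WithLp.prod_continuous_toLp 2 H (EuclideanSpace ℝ (Fin m))).tendsto _).comp
      (hxa.prodMk_nhds tendsto_const_nhds)
  exact hF.mem_of_frequently_of_tendsto hfreq hcont

theorem le_sectionProb_iInter [IsFiniteMeasure P] (hξ : Measurable ξ)
    {G : ℕ → Set (WithLp 2 (H × EuclideanSpace ℝ (Fin m)))} (hG : ∀ n, IsClosed (G n))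
    (hanti : Antitone G) (hGF : ⋂ n, G n ⊆ F) {p : ℝ} {x : H}
    (hx : ∀ n, p ≤ sectionProb P ξ (G n) x) : p ≤ sectionProb P ξ F x := by
  have hlim := tendsto_measure_iInter_atTop (μ := P)
    (s := fun n => {ω | WithLp.toLp 2 (x, ξ ω) ∈ G n})
    (fun n => (hξ (measurableSet_section (hG n) x)).nullMeasurableSet)
    (fun i j hij ω hω => hanti hij hω) ⟨0, measure_ne_top _ _⟩
  have hlim' := (ENNReal.tendsto_toReal (measure_ne_top P _)).comp hlim
  refine (ge_of_tendsto' hlim' hx).trans (measureReal_mono fun ω hω => hGF ?_)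
  exact Set.mem_iInter.2 fun n => Set.mem_iInter.1 hω n

variable [NormedSpace ℝ H]

theorem genMean_le_sectionProb [IsFiniteMeasure P] (hξ : Measurable ξ) (hF : IsClosed F)
    (hFc : Convex ℝ F) {α : EReal} (hα : AlphaConcaveMeasure α (P.map ξ)) (x y : H) {t : ℝ}
    (ht : t ∈ Set.Icc (0 : ℝ) 1) :
    genMean α (sectionProb P ξ F x) (sectionProb P ξ F y) t ≤
      sectionProb P ξ F (t • x + (1 - t) • y) := by
  rw [sectionProb_eq hξ hF, sectionProb_eq hξ hF, sectionProb_eq hξ hF]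
  refine (hα _ _ (measurableSet_section hF x) (measurableSet_section hF y) t ht).trans
    (measureReal_mono ?_)
  rintro _ ⟨a, ha, b, hb, rfl⟩
  exact hFc ha hb ht.1 (sub_nonneg.2 ht.2) (add_sub_cancel _ _)

theorem alphaConcaveOn_sectionProb [IsFiniteMeasure P] (hξ : Measurable ξ) (hF : IsClosed F)
    (hFc : Convex ℝ F) {α : EReal} (hα : AlphaConcaveMeasure α (P.map ξ)) :
    AlphaConcaveOn α {x | ∃ z, WithLp.toLp 2 (x, z) ∈ F} (sectionProb P ξ F) := by
  refine ⟨?_, fun x _ => measureReal_nonneg, fun x _ y _ t ht =>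
    genMean_le_sectionProb hξ hF hFc hα x y ht⟩
  rintro x ⟨z, hz⟩ y ⟨w, hw⟩ a b ha hb hab
  exact ⟨a • z + b • w, hFc hz hw ha hb hab⟩

theorem convex_le_sectionProb [IsFiniteMeasure P] (hξ : Measurable ξ) (hF : IsClosed F)
    (hFc : Convex ℝ F) {α : EReal} (hα : AlphaConcaveMeasure α (P.map ξ)) (p : ℝ) :
    Convex ℝ {x | p ≤ sectionProb P ξ F x} := by
  intro x hx y hy a b ha hb hab
  rcases le_or_gt p 0 with hp | hp
  · exact hp.trans measureReal_nonneg
  · obtain rfl : b = 1 - a := by linarith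
    have ht : a ∈ Set.Icc (0 : ℝ) 1 := ⟨ha, by linarith⟩
    exact (le_min hx hy).trans ((min_le_genMean (hp.trans_le hx) (hp.trans_le hy) ht).trans
      (genMean_le_sectionProb hξ hF hFc hα x y ht))

end Sections

/-! ### The supremum function and the cone constraint -/

section Sup

variable {H : Type*} [NormedAddCommGroup H] {Y : Type*} [NormedAddCommGroup Y] [NormedSpace ℝ Y]
  {m : ℕ} {C : Set (WeakDual ℝ Y)} {K : ConvexCone ℝ Y} {Φ : H → EuclideanSpace ℝ (Fin m) → Y}

theorem zero_mem_of_isClosed (hKne : (K : Set Y).Nonempty) (hKcl : IsClosed (K : Set Y)) :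
    (0 : Y) ∈ K := by
  obtain ⟨y, hy⟩ := hKne
  have hcont : Tendsto (fun d : ℝ => d • y) (𝓝[>] 0) (𝓝 0) := by
    have : Continuous (fun d : ℝ => d • y) := by fun_prop
    simpa using (this.tendsto 0).mono_left nhdsWithin_le_nhds
  refine hKcl.mem_of_tendsto hcont ?_
  filter_upwards [self_mem_nhdsWithin] with d hd using K.smul_mem hd hy

theorem GeneratesPolar.nonempty (hC : GeneratesPolar C K) : C.Nonempty := by
  by_contra h
  rw [Set.not_nonempty_iff_eq_empty] at h
  have h0 : (0 : WeakDual ℝ Y) ∈ {w : WeakDual ℝ Y | ∀ y ∈ K, 0 ≤ w y} := fun y _ => le_rfl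
  rw [← hC.2.2, h] at h0
  simp at h0

/-- If `-Φ` is not in `K`, a functional nonnegative on `K` is negative there. Negativity at one
vector is a weak-star open condition, so some `t • v` with `t ≥ 0` and `v ∈ C` shares it,
contradicting `v (Φ) ≤ 0`. -/
theorem neg_mem_iff_supFun_le (hKne : (K : Set Y).Nonempty) (hKcl : IsClosed (K : Set Y))
    (hC : GeneratesPolar C K) (q : WithLp 2 (H × EuclideanSpace ℝ (Fin m))) :
    -Φ q.fst q.snd ∈ K ↔ supFun C Φ q ≤ 0 := by
  constructor
  · intro h
    refine iSup₂_le fun v hv => ?_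
    have hvK : v ∈ {w : WeakDual ℝ Y | ∀ y ∈ K, 0 ≤ w y} := by
      rw [← hC.2.2]
      exact subset_closure ⟨1, zero_le_one, v, hv, (one_smul _ _).symm⟩
    have h1 := hvK _ h
    rw [map_neg] at h1
    exact_mod_cast neg_nonneg.1 h1
  · intro h
    by_contra hcon
    obtain ⟨f, s, hfs, hK⟩ := geometric_hahn_banach_point_closed K.convex hKcl hcon
    have hs : s < 0 := by simpa using hK 0 (zero_mem_of_isClosed hKne hKcl)
    have hfK : StrongDual.toWeakDual f ∈ {w : WeakDual ℝ Y | ∀ y ∈ K, 0 ≤ w y} := by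
      intro y hy
      show 0 ≤ f y
      by_contra! hneg
      -- This rescaling brings the value of `f` exactly to `s`, whereas `f > s` on `K`.
      have h1 := hK ((s / f y) • y) (K.smul_mem (div_pos_of_neg_of_neg hs hneg) hy)
      rw [map_smul, smul_eq_mul, div_mul_cancel₀ _ hneg.ne] at h1
      exact lt_irrefl _ h1
    rw [← hC.2.2] at hfK
    obtain ⟨w, hw, t, ht, v, hv, rfl⟩ := mem_closure_iff.1 hfK
      {w : WeakDual ℝ Y | w (-Φ q.fst q.snd) < 0}
      (isOpen_lt (WeakDual.eval_continuous _) continuous_const) (hfs.trans hs)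
    have h1 : v (Φ q.fst q.snd) ≤ 0 := by
      have := (le_iSup₂ (f := fun (v : WeakDual ℝ Y) (_ : v ∈ C) =>
        ((v (Φ q.fst q.snd) : ℝ) : EReal)) v hv).trans h
      exact_mod_cast this
    have h2 : t * v (-Φ q.fst q.snd) < 0 := hw
    rw [map_neg] at h2
    nlinarith

theorem lowerSemicontinuous_supFun
    (hΦ : Continuous (fun q : H × EuclideanSpace ℝ (Fin m) => Φ q.1 q.2)) :
    LowerSemicontinuous (supFun C Φ) := by
  refine lowerSemicontinuous_biSup fun v _ => Continuous.lowerSemicontinuous ?_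
  exact continuous_coe_real_ereal.comp ((map_continuous v).comp
    (hΦ.comp (WithLp.prod_continuous_ofLp 2 H (EuclideanSpace ℝ (Fin m)))))

theorem supFun_ne_bot (hC : C.Nonempty) (q : WithLp 2 (H × EuclideanSpace ℝ (Fin m))) :
    supFun C Φ q ≠ ⊥ := by
  obtain ⟨v, hv⟩ := hC
  have := le_iSup₂ (f := fun (v : WeakDual ℝ Y) (_ : v ∈ C) =>
        ((v (Φ q.fst q.snd) : ℝ) : EReal)) v hv
  exact ((EReal.bot_lt_coe _).trans_le this).ne'

theorem supFun_lt_top (hC : IsCompact C) (q : WithLp 2 (H × EuclideanSpace ℝ (Fin m))) :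
    supFun C Φ q < ⊤ := by
  obtain ⟨b, hb⟩ := (hC.image (WeakDual.eval_continuous (Φ q.fst q.snd))).bddAbove
  refine lt_of_le_of_lt (iSup₂_le fun v hv => ?_) (EReal.coe_lt_top b)
  exact_mod_cast hb ⟨v, hv, rfl⟩

theorem convexFun_supFun [NormedSpace ℝ H] (hconv : ∀ v ∈ C,
      ConvexOn ℝ Set.univ (fun q : H × EuclideanSpace ℝ (Fin m) => v (Φ q.1 q.2))) :
    ConvexFun (supFun C Φ) := by
  rintro ⟨x, r⟩ hx ⟨y, s⟩ hy a b ha hb hab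
  refine (iSup₂_le fun v hv => ?_ : supFun C Φ (a • x + b • y) ≤ ((a * r + b * s : ℝ) : EReal))
  have h1 : ∀ {q : WithLp 2 (H × EuclideanSpace ℝ (Fin m))} {c : ℝ}, supFun C Φ q ≤ (c : EReal) →
      v (Φ q.fst q.snd) ≤ c := by
    intro q c hq
    have := (le_iSup₂ (f := fun (v : WeakDual ℝ Y) (_ : v ∈ C) =>
        ((v (Φ q.fst q.snd) : ℝ) : EReal)) v hv).trans hq
    exact_mod_cast this
  have h2 := (hconv v hv).2 (Set.mem_univ x.ofLp) (Set.mem_univ y.ofLp) ha hb hab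
  refine EReal.coe_le_coe_iff.2 (h2.trans ?_)
  exact add_le_add (mul_le_mul_of_nonneg_left (h1 hx) ha) (mul_le_mul_of_nonneg_left (h1 hy) hb)

end Sup

/-! ### Uniqueness and convergence of minimizers -/

section Optimization

variable {E : Type*} [NormedAddCommGroup E] [InnerProductSpace ℝ E]
  {ψ : E → EReal}

theorem eq_of_le_of_subgradient (hbot : ∀ x, ψ x ≠ ⊥) {x0 x1 u : E} (hx0 : ψ x0 < ⊤)
    (hu : ∀ y, ψ x0 + ((inner ℝ u (y - x0) : ℝ) : EReal) ≤ ψ y)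
    (hdiff : (subdiff (conjugate ψ) u).Nonempty → FrechetDifferentiableAt (conjugate ψ) u)
    (h1 : ψ x1 ≤ ψ x0 + ((inner ℝ u (x1 - x0) : ℝ) : EReal)) : x1 = x0 := by
  rw [← sub_eq_zero, ← norm_le_zero_iff]
  refine le_of_forall_pos_le_add fun η hη => ?_
  obtain ⟨ε, hε, h⟩ := exists_pos_forall_norm_sub_le hbot hx0 hu hdiff hη
  rw [zero_add]
  refine h x1 (h1.trans ?_)
  gcongr
  linarith

variable [CompleteSpace E]

theorem existsUnique_isOptimal (hbot : ∀ x, ψ x ≠ ⊥) (hcv : ConvexFun ψ) (hco : CoerciveFun ψ)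
    (hlsc : LowerSemicontinuous ψ)
    (hdiff : ∀ u, (subdiff (conjugate ψ) u).Nonempty → FrechetDifferentiableAt (conjugate ψ) u)
    {M : Set E} (hM : Convex ℝ M) (hMc : IsClosed M) (hMi : (M ∩ interior (effDom ψ)).Nonempty) :
    ∃! x, IsOptimal ψ M x := by
  obtain ⟨xb, hxb, hxbi⟩ := hMi
  have hxbt := lt_top_of_mem_interior hxbi
  obtain ⟨x0, h0⟩ := exists_isOptimal hcv hco hlsc hM hMc ⟨xb, hxb, hxbt⟩
  refine ⟨x0, h0, fun x1 h1 => ?_⟩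
  obtain ⟨u, hu, huM⟩ := h0.exists_subgradient hbot hcv hlsc hM ⟨xb, hxb, hxbi⟩
  refine eq_of_le_of_subgradient hbot ((h0.2 xb hxb).trans_lt hxbt) hu (hdiff u) ?_
  exact (h1.2 x0 h0.1).trans (le_add_of_nonneg_right (by exact_mod_cast huM x1 h1.1))

/-- Two minimizers share a subgradient `u` of the envelope, so both points `x - l • u` minimize `ψ -
⟨u, ·⟩`; strong minimality identifies them. The envelope is finite everywhere, so `M` need only be
nonempty. -/
theorem existsUnique_isOptimal_moreauEnvelope (hbot : ∀ x, ψ x ≠ ⊥) (hcv : ConvexFun ψ)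
    (hco : CoerciveFun ψ) (hlsc : LowerSemicontinuous ψ)
    (hdiff : ∀ u, (subdiff (conjugate ψ) u).Nonempty → FrechetDifferentiableAt (conjugate ψ) u)
    (hne : ∃ x, ψ x < ⊤) {M : Set E} (hM : Convex ℝ M) (hMc : IsClosed M) (hMne : M.Nonempty)
    {l : ℝ} (hl : 0 < l) : ∃! x, IsOptimal (moreauEnvelope ψ l) M x := by
  obtain ⟨z, hz⟩ := hne
  obtain ⟨c, hc⟩ := exists_real_le hbot hcv hco hlsc
  have hbot' : ∀ x, moreauEnvelope ψ l x ≠ ⊥ := fun x =>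
    ((EReal.bot_lt_coe c).trans_le (le_moreauEnvelope hc hl x)).ne'
  have htop := moreauEnvelope_lt_top (l := l) hz
  have hlsc' := lowerSemicontinuous_moreauEnvelope hcv hl hbot' ⟨z, hz⟩
  have hcv' := hcv.moreauEnvelope hl
  obtain ⟨xb, hxb⟩ := hMne
  obtain ⟨x0, h0⟩ := exists_isOptimal hcv' (hco.moreauEnvelope hc hl) hlsc' hM hMc
    ⟨xb, hxb, htop xb⟩
  refine ⟨x0, h0, fun x1 h1 => ?_⟩
  have hdom : effDom (moreauEnvelope ψ l) = Set.univ := Set.eq_univ_iff_forall.2 htop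
  obtain ⟨u, hu, huM⟩ := h0.exists_subgradient hbot' hcv' hlsc' hM
    ⟨xb, hxb, by rw [hdom, interior_univ]; trivial⟩
  have heq : moreauEnvelope ψ l x1 = moreauEnvelope ψ l x0 :=
    le_antisymm (h1.2 x0 h0.1) (h0.2 x1 h1.1)
  have hzero : inner ℝ u (x1 - x0) = 0 := by
    refine le_antisymm ?_ (huM x1 h1.1)
    have h := hu x1
    rw [heq, ← EReal.coe_toReal (htop x0).ne (hbot' x0), ← EReal.coe_add,
      EReal.coe_le_coe_iff] at h
    linarith
  have hu1 : ∀ y, moreauEnvelope ψ l x1 + ((inner ℝ u (y - x1) : ℝ) : EReal) ≤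
      moreauEnvelope ψ l y := by
    intro y
    have h : inner ℝ u (y - x1) = inner ℝ u (y - x0) := by
      rw [← sub_sub_sub_cancel_right y x1 x0, inner_sub_right u (y - x0), hzero, sub_zero]
    rw [h, heq]
    exact hu y
  obtain ⟨ht0, hs0⟩ := subgradient_of_moreauEnvelope hbot hcv hco hlsc ⟨z, hz⟩ hl hu
  obtain ⟨ht1, hs1⟩ := subgradient_of_moreauEnvelope hbot hcv hco hlsc ⟨z, hz⟩ hl hu1
  have h := eq_of_le_of_subgradient hbot ht0 hs0 (hdiff u) (x1 := x1 - l • u) ?_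
  · exact sub_left_injective h
  · have h2 := hs1 (x0 - l • u)
    rw [sub_sub_sub_cancel_right] at h2 ⊢
    rw [← neg_sub x1 x0, inner_neg_right, hzero, neg_zero, EReal.coe_zero, add_zero] at h2
    rwa [hzero, EReal.coe_zero, add_zero]

/-- Minimizers of the Moreau envelopes over outer approximations of the feasible set converge to
the minimizer of the original problem. -/
theorem tendsto_isOptimal_moreauEnvelope (hbot : ∀ x, ψ x ≠ ⊥) (hcv : ConvexFun ψ)
    (hco : CoerciveFun ψ) (hlsc : LowerSemicontinuous ψ)
    (hdiff : ∀ u, (subdiff (conjugate ψ) u).Nonempty → FrechetDifferentiableAt (conjugate ψ) u)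
    {M : Set E} (hM : Convex ℝ M) (hMi : (M ∩ interior (effDom ψ)).Nonempty)
    {N : ℝ → Set E} (hNcv : ∀ l, 0 < l → Convex ℝ (N l)) (hNcl : ∀ l, 0 < l → IsClosed (N l))
    (hNM : ∀ l, 0 < l → M ⊆ N l) (hNmono : ∀ l l', 0 < l → l ≤ l' → N l ⊆ N l')
    (hNinter : ⋂ n : ℕ, N (1 / ((n : ℝ) + 1)) ⊆ M) {x0 : E} (h0 : IsOptimal ψ M x0)
    {s : ℝ → E} (hs : ∀ l, 0 < l → IsOptimal (moreauEnvelope ψ l) (N l) (s l)) :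
    Tendsto s (𝓝[>] 0) (𝓝 x0) := by
  obtain ⟨u, hu, huM⟩ := h0.exists_subgradient hbot hcv hlsc hM hMi
  obtain ⟨xb, hxb, hxbi⟩ := hMi
  have hx0 : ψ x0 < ⊤ := (h0.2 xb hxb).trans_lt (lt_top_of_mem_interior hxbi)
  obtain ⟨c, hc⟩ := exists_real_le hbot hcv hco hlsc
  set r0 := (ψ x0).toReal with hr0
  have hfr : ψ x0 = (r0 : EReal) := (EReal.coe_toReal hx0.ne (hbot x0)).symm
  have hle : ∀ l, 0 < l → moreauEnvelope ψ l (s l) ≤ (r0 : EReal) := fun l hl =>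
    ((hs l hl).2 x0 (hNM l hl h0.1)).trans ((moreauEnvelope_le_self ψ l x0).trans hfr.le)
  have hpos : ∀ n : ℕ, 0 < 1 / ((n : ℝ) + 1) := fun n => Nat.one_div_pos_of_nat
  -- Otherwise the sets below are nonempty for every `n`, and a common point lies in `M` with `⟨u, x
  -- - x0⟩ ≤ -δ`, against normality. Since the envelope with parameter `1` lies below those with `l
  -- ≤ 1`, one bounded sublevel set contains every `s l` with `0 < l ≤ 1`.
  have hlow : ∀ δ > 0, ∀ᶠ l in 𝓝[>] (0 : ℝ), -δ < inner ℝ u (s l - x0) := by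
    intro δ hδ
    by_contra hcon
    rw [not_eventually] at hcon
    obtain ⟨x, hx⟩ := exists_mem_forall_of_antitone (fun n : ℕ => N (1 / ((n : ℝ) + 1)) ∩
        ({x | inner ℝ u (x - x0) ≤ -δ} ∩ {x | moreauEnvelope ψ 1 x ≤ (r0 : EReal)}))
      (fun i j hij x hx => ⟨hNmono _ _ (hpos j) (Nat.one_div_le_one_div hij) hx.1, hx.2⟩)
      (fun n => (hNcl _ (hpos n)).inter
        ((isClosed_le (by fun_prop) continuous_const).inter
          ((lowerSemicontinuous_moreauEnvelope hcv one_pos (fun x =>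
            ((EReal.bot_lt_coe c).trans_le (le_moreauEnvelope hc one_pos x)).ne')
            ⟨x0, hx0⟩).isClosed_preimage _)))
      (fun n => (hNcv _ (hpos n)).inter (by
        refine Convex.inter ?_ ((hcv.moreauEnvelope one_pos).convex_le r0)
        have h : {x | inner ℝ u (x - x0) ≤ -δ} = {x | innerSL ℝ u x ≤ -δ + inner ℝ u x0} := by
          ext x
          simp only [Set.mem_ofPred_eq, innerSL_apply_apply, inner_sub_right]
          constructor <;> intro h <;> linarith
        rw [h]
        exact convex_halfSpace_le (innerSL ℝ u).toLinearMap.isLinear _))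
      (fun n => by
        have hev : ∀ᶠ l in 𝓝[>] (0 : ℝ), l ∈ Set.Ioo 0 (1 / ((n : ℝ) + 1)) :=
          Ioo_mem_nhdsGT (hpos n)
        obtain ⟨l, hl, hln⟩ := (hcon.and_eventually hev).exists
        have hl1 : l ≤ 1 := hln.2.le.trans (by
          rw [div_le_one (by positivity)]
          linarith [(Nat.cast_nonneg n : (0 : ℝ) ≤ n)])
        exact ⟨s l, hNmono _ _ hln.1 hln.2.le (hs l hln.1).1, not_lt.1 hl,
          (moreauEnvelope_anti ψ hln.1 hl1 _).trans (hle l hln.1)⟩)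
      ((hco.moreauEnvelope hc one_pos r0).subset fun x hx => hx.2.2)
    have h1 := huM x (hNinter (Set.mem_iInter.2 fun n => (hx n).1))
    have h2 : inner ℝ u (x - x0) ≤ -δ := (hx 0).2.1
    linarith
  rw [Metric.tendsto_nhds]
  intro e he
  obtain ⟨ε, hε, hstrong⟩ := exists_pos_forall_norm_sub_le hbot hx0 hu (hdiff u)
    (by positivity : 0 < e / 3)
  -- `d` bounds the distance from `s l` to its proximal point `z`: the first bound serves the final
  -- triangle inequality, the second keeps `‖u‖ * d` below `ε / 2`. The `+ 1` in each denominator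
  -- guards against `u = 0` and `r0 = c`.
  set d := min (e / 3) (ε / 2 / (‖u‖ + 1)) with hd
  have hd0 : 0 < d := lt_min (by positivity) (by positivity)
  have hrc : c ≤ r0 := EReal.coe_le_coe_iff.1 ((hc x0).trans hfr.le)
  have hsmall : ∀ᶠ l in 𝓝[>] (0 : ℝ), l ∈ Set.Ioo 0 (d ^ 2 / (2 * (r0 - c) + 1)) :=
    Ioo_mem_nhdsGT (div_pos (by positivity) (by linarith))
  filter_upwards [hlow (ε / 2) (by positivity), hsmall] with l h1 hl
  obtain ⟨hl0, hl1⟩ := hl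
  obtain ⟨z, hzt, hz⟩ := exists_moreauEnvelope_eq hcv hco hlsc ⟨x0, hx0⟩ hl0 (s l)
  have hzr : ψ z = ((ψ z).toReal : EReal) := (EReal.coe_toReal hzt.ne (hbot z)).symm
  have h2 := hle l hl0
  rw [hz, hzr, ← EReal.coe_add, EReal.coe_le_coe_iff] at h2
  have h3 : c ≤ (ψ z).toReal := EReal.coe_le_coe_iff.1 ((hc z).trans hzr.le)
  have h4 : ‖s l - z‖ ≤ d := by
    have h5 : ‖s l - z‖ ^ 2 ≤ 2 * l * (r0 - c) := by
      have h6 := mul_le_mul_of_nonneg_left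
        (show 1 / (2 * l) * ‖s l - z‖ ^ 2 ≤ r0 - c by linarith) (by positivity : 0 ≤ 2 * l)
      rwa [← mul_assoc, mul_one_div_cancel (by positivity), one_mul] at h6
    rw [lt_div_iff₀ (by linarith)] at hl1
    exact le_of_sq_le_sq (by nlinarith) hd0.le
  have h5 : ‖z - x0‖ ≤ e / 3 := by
    refine hstrong z ?_
    rw [hzr, hfr, ← EReal.coe_add, EReal.coe_le_coe_iff]
    have h6 : inner ℝ u (s l - z) ≤ ε / 2 := by
      refine (real_inner_le_norm _ _).trans ?_
      have h7 : d ≤ ε / 2 / (‖u‖ + 1) := min_le_right _ _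
      rw [le_div_iff₀ (by positivity)] at h7
      nlinarith [norm_nonneg u, norm_nonneg (s l - z)]
    rw [← sub_sub_sub_cancel_right (s l) z x0, inner_sub_right u (s l - x0)] at h6
    have h7 : 0 ≤ 1 / (2 * l) * ‖s l - z‖ ^ 2 := by positivity
    linarith
  rw [dist_eq_norm, ← sub_add_sub_cancel (s l) z x0]
  have h6 : d ≤ e / 3 := min_le_left _ _
  exact (norm_add_le _ _).trans_lt (by linarith)

/-- The Moreau envelopes of a finite convex lower semicontinuous function approximate it. -/
theorem exists_sub_le_moreauEnvelope {f : E → EReal} (hbot : ∀ x, f x ≠ ⊥) (htop : ∀ x, f x < ⊤)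
    (hcv : ConvexFun f) (hlsc : LowerSemicontinuous f) (x : E) :
    ∃ b : ℝ, ∀ l, 0 < l → (((f x).toReal - l * b : ℝ) : EReal) ≤ moreauEnvelope f l x := by
  have hdom : effDom f = Set.univ := Set.eq_univ_iff_forall.2 htop
  -- Every point is optimal over its own singleton, so the first-order condition yields a
  -- subgradient at any `x`.
  have hopt : IsOptimal f {x} x := ⟨rfl, fun y hy => by rw [Set.mem_singleton_iff.1 hy]⟩
  obtain ⟨u, hu, -⟩ := hopt.exists_subgradient hbot hcv hlsc (convex_singleton x)
    ⟨x, rfl, by rw [hdom, interior_univ]; trivial⟩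
  rw [← EReal.coe_toReal (htop x).ne (hbot x)] at hu
  refine ⟨‖u‖ ^ 2 / 2, fun l hl => ?_⟩
  rw [show l * (‖u‖ ^ 2 / 2) = l / 2 * ‖u‖ ^ 2 by ring]
  exact sub_le_moreauEnvelope hu hl

theorem isClosed_moreauEnvelope_le {f : E → EReal} (hbot : ∀ x, f x ≠ ⊥) (htop : ∀ x, f x < ⊤)
    (hcv : ConvexFun f) (hlsc : LowerSemicontinuous f) {l : ℝ} (hl : 0 < l) :
    IsClosed {x | moreauEnvelope f l x ≤ 0} := by
  refine (lowerSemicontinuous_moreauEnvelope hcv hl (fun x => ?_) ⟨0, htop 0⟩).isClosed_preimage 0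
  obtain ⟨b, hb⟩ := exists_sub_le_moreauEnvelope hbot htop hcv hlsc x
  exact ((EReal.bot_lt_coe _).trans_le (hb l hl)).ne'

theorem iInter_moreauEnvelope_le_subset {f : E → EReal} (hbot : ∀ x, f x ≠ ⊥) (htop : ∀ x, f x < ⊤)
    (hcv : ConvexFun f) (hlsc : LowerSemicontinuous f) :
    ⋂ n : ℕ, {x | moreauEnvelope f (1 / ((n : ℝ) + 1)) x ≤ 0} ⊆ {x | f x ≤ 0} := by
  intro x hx
  obtain ⟨b, hb⟩ := exists_sub_le_moreauEnvelope hbot htop hcv hlsc x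
  have h1 : ∀ n : ℕ, (f x).toReal - 1 / ((n : ℝ) + 1) * b ≤ 0 := fun n => by
    exact_mod_cast (hb _ Nat.one_div_pos_of_nat).trans (Set.mem_iInter.1 hx n)
  have h2 : Tendsto (fun n : ℕ => (f x).toReal - 1 / ((n : ℝ) + 1) * b) atTop
      (𝓝 ((f x).toReal - 0 * b)) :=
    tendsto_const_nhds.sub (tendsto_one_div_add_atTop_nhds_zero_nat.mul_const b)
  have h3 := le_of_tendsto' h2 h1
  rw [zero_mul, sub_zero] at h3
  rw [Set.mem_ofPred_eq, ← EReal.coe_toReal (htop x).ne (hbot x)]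
  exact_mod_cast h3

end Optimization

end ChanceConstrained

/-! ### Assembly of the main theorem -/

theorem mainTheorem6
    {H : Type*} [NormedAddCommGroup H] [InnerProductSpace ℝ H] [CompleteSpace H]
    [TopologicalSpace.SeparableSpace H]
    {Y : Type*} [NormedAddCommGroup Y] [NormedSpace ℝ Y] [CompleteSpace Y]
    {Ω : Type*} [MeasurableSpace Ω] (P : Measure Ω) [IsProbabilityMeasure P]
    {m : ℕ} (ξ : Ω → EuclideanSpace ℝ (Fin m)) (hξ : Measurable ξ)
    (K : ConvexCone ℝ Y) (hKne : (K : Set Y).Nonempty) (hKcl : IsClosed (K : Set Y))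
    (C : Set (WeakDual ℝ Y)) (hC : ChanceConstrained.GeneratesPolar C K)
    (Φ : H → EuclideanSpace ℝ (Fin m) → Y)
    (hΦ : Continuous (fun q : H × EuclideanSpace ℝ (Fin m) => Φ q.1 q.2))
    (hconv : ∀ v ∈ C,
      ConvexOn ℝ Set.univ (fun q : H × EuclideanSpace ℝ (Fin m) => v (Φ q.1 q.2)))
    (α : EReal) (hα : ChanceConstrained.AlphaConcaveMeasure α (P.map ξ)) :
    (∀ l : ℝ, 0 < l →
      ChanceConstrained.AlphaConcaveOn α {x | ∃ z, ChanceConstrained.regFun C Φ l x z ≤ 0}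
        (ChanceConstrained.regProbFun P ξ C Φ l)) ∧
    ChanceConstrained.AlphaConcaveOn α {x | ∃ z, -Φ x z ∈ K}
      (ChanceConstrained.probFun P ξ K Φ) ∧
    (∀ p ∈ Set.Icc (0 : ℝ) 1,
      (∀ l : ℝ, 0 < l → Convex ℝ (ChanceConstrained.regFeasible P ξ C Φ l p)) ∧
      Convex ℝ (ChanceConstrained.feasible P ξ K Φ p)) ∧
    (∀ p ∈ Set.Icc (0 : ℝ) 1, ∀ ψ : H → EReal,
      (∀ x, ψ x ≠ ⊥) →
      ChanceConstrained.ConvexFun ψ →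
      ChanceConstrained.CoerciveFun ψ →
      LowerSemicontinuous ψ →
      (ChanceConstrained.feasible P ξ K Φ p ∩
        interior (ChanceConstrained.effDom ψ)).Nonempty →
      (∀ u : H, (ChanceConstrained.subdiff (ChanceConstrained.conjugate ψ) u).Nonempty →
        ChanceConstrained.FrechetDifferentiableAt (ChanceConstrained.conjugate ψ) u) →
      (∃! x, ChanceConstrained.IsOptimal ψ (ChanceConstrained.feasible P ξ K Φ p) x) ∧
      (∀ l : ℝ, 0 < l →
        ∃! x, ChanceConstrained.IsOptimal (ChanceConstrained.moreauEnvelope ψ l)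
          (ChanceConstrained.regFeasible P ξ C Φ l p) x) ∧
      (∀ (x₀ : H) (s : ℝ → H),
        ChanceConstrained.IsOptimal ψ (ChanceConstrained.feasible P ξ K Φ p) x₀ →
        (∀ l : ℝ, 0 < l →
          ChanceConstrained.IsOptimal (ChanceConstrained.moreauEnvelope ψ l)
            (ChanceConstrained.regFeasible P ξ C Φ l p) (s l)) →
        Tendsto s (𝓝[>] 0) (𝓝 x₀))) := by
  open ChanceConstrained in
  have hbot := supFun_ne_bot (Φ := Φ) hC.nonempty
  have htop := supFun_lt_top (Φ := Φ) hC.1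
  have hcv := convexFun_supFun hconv
  have hlsc := lowerSemicontinuous_supFun (C := C) hΦ
  set F0 : Set (WithLp 2 (H × EuclideanSpace ℝ (Fin m))) := {q | -Φ q.fst q.snd ∈ K} with hF0
  set F : ℝ → Set (WithLp 2 (H × EuclideanSpace ℝ (Fin m))) :=
    fun l => {q | moreauEnvelope (supFun C Φ) l q ≤ 0} with hF
  have hF0eq : F0 = {q | supFun C Φ q ≤ 0} :=
    Set.ext fun q => neg_mem_iff_supFun_le hKne hKcl hC q
  have hF0cl : IsClosed F0 := by rw [hF0eq]; exact hlsc.isClosed_preimage 0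
  have hF0cv : Convex ℝ F0 := by rw [hF0eq]; exact_mod_cast hcv.convex_le 0
  have hFcl : ∀ l, 0 < l → IsClosed (F l) := fun l hl =>
    isClosed_moreauEnvelope_le hbot htop hcv hlsc hl
  have hFcv : ∀ l, 0 < l → Convex ℝ (F l) := fun l hl => by
    exact_mod_cast (hcv.moreauEnvelope hl).convex_le 0
  have hF0F : ∀ l, F0 ⊆ F l := fun l q hq => by
    rw [hF0eq] at hq
    exact (moreauEnvelope_le_self _ l q).trans hq
  have hFmono : ∀ l l', 0 < l → l ≤ l' → F l ⊆ F l' := fun l l' hl hll q hq =>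
    (moreauEnvelope_anti _ hl hll q).trans hq
  have hFinter : ⋂ n : ℕ, F (1 / ((n : ℝ) + 1)) ⊆ F0 := by
    rw [hF0eq]
    exact iInter_moreauEnvelope_le_subset hbot htop hcv hlsc
  -- `probFun` and `regProbFun` are, by unfolding, `sectionProb` of `F0` and of `F l`, so the
  -- section lemmas apply to both.
  have hMcv : ∀ p, Convex ℝ (feasible P ξ K Φ p) := convex_le_sectionProb hξ hF0cl hF0cv hα
  have hMcl : ∀ p, IsClosed (feasible P ξ K Φ p) := isClosed_le_sectionProb hξ hF0cl
  have hNcv : ∀ l, 0 < l → ∀ p, Convex ℝ (regFeasible P ξ C Φ l p) := fun l hl =>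
    convex_le_sectionProb hξ (hFcl l hl) (hFcv l hl) hα
  have hNcl : ∀ l, 0 < l → ∀ p, IsClosed (regFeasible P ξ C Φ l p) := fun l hl =>
    isClosed_le_sectionProb hξ (hFcl l hl)
  have hMN : ∀ l p, feasible P ξ K Φ p ⊆ regFeasible P ξ C Φ l p := fun l p x hx =>
    le_trans hx (sectionProb_mono (hF0F l) x)
  refine ⟨fun l hl => alphaConcaveOn_sectionProb hξ (hFcl l hl) (hFcv l hl) hα,
    alphaConcaveOn_sectionProb hξ hF0cl hF0cv hα, fun p _ => ⟨fun l hl => hNcv l hl p, hMcv p⟩, ?_⟩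
  intro p _ ψ hψbot hψcv hψco hψlsc hMi hdiff
  have hne : ∃ x, ψ x < ⊤ := hMi.imp fun x hx => lt_top_of_mem_interior hx.2
  refine ⟨existsUnique_isOptimal hψbot hψcv hψco hψlsc hdiff (hMcv p) (hMcl p) hMi,
    fun l hl => existsUnique_isOptimal_moreauEnvelope hψbot hψcv hψco hψlsc hdiff hne
      (hNcv l hl p) (hNcl l hl p) (hMi.left.mono (hMN l p)) hl,
    fun x₀ s h0 hs => tendsto_isOptimal_moreauEnvelope hψbot hψcv hψco hψlsc hdiff (hMcv p) hMi
      (fun l hl => hNcv l hl p) (fun l hl => hNcl l hl p) (fun l _ => hMN l p)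
      (fun l l' hl hll x hx => le_trans hx (sectionProb_mono (hFmono l l' hl hll) x))
      (fun x hx => le_sectionProb_iInter hξ (fun n => hFcl _ Nat.one_div_pos_of_nat)
        (fun i j hij => hFmono _ _ Nat.one_div_pos_of_nat (Nat.one_div_le_one_div hij)) hFinter
        (fun n => Set.mem_iInter.1 hx n)) h0 hs⟩
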